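/- Let $\alpha,\beta\ge 0$. Call an additive subgroup $\mathcal C\subseteq\mathbb Z_2^\alpha\times\mathbb Z_4^\beta$ a *$\mathbb Z_2\mathbb Z_4$-additive code*. Let $\Phi:\mathbb Z_2^\alpha\times\mathbb Z_4^\beta\to\mathbb Z_2^{\alpha+2\beta}$ be the map that is the identity on the binary coordinates and the Gray map $0\mapsto00,\ 1\mapsto01,\ 2\mapsto11,\ 3\mapsto10$ on each quaternary coordinate. The code $\mathcal C$ is *1-perfect* if every vector of $\mathbb Z_2^{\alpha+2\beta}$ is at Hamming distance at most $1$ from exactly one element of $\Phi(\mathcal C)$. Its *extended code* $\mathcal C'\subseteq\mathbb Z_2^{\alpha+1}\times\mathbb Z_4^\beta$ is obtained by inserting into each codeword $\mathbf u\in\mathcal C$ one further binary coordinate, at a fixed position among the binary coordinates, equal to the sum modulo $2$ of all bits of $\Phi(\mathbf u)$. A $\mathbb Z_2\mathbb Z_4$-additive code is *$\mathbb Z_2\mathbb Z_4$-cyclic* if it is closed under the double right cyclic shift $$(u_1,\dots,u_a\mid u'_1,\dots,u'_b)\mapsto(u_a,u_1,\dots,u_{a-1}\mid u'_b,u'_1,\dots,u'_{b-1}).$$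 **Theorem.** Let $t\ge 3$ and let $\mathcal C\subseteq\mathbb Z_2^\alpha\times\mathbb Z_4^\beta$ be a $\mathbb Z_2\mathbb Z_4$-additive 1-perfect code of binary length $\alpha+2\beta=2^t-1$. Then, whatever the position of the parity coordinate among the binary coordinates, the extended code $\mathcal C'$ is not $\mathbb Z_2\mathbb Z_4$-cyclic. (In particular this holds for the codes $\mathcal C'_{r,t}$ with $t\ge3$, where for $2\le r\le t\le 2r$ one denotes by $\mathcal C_{r,t}$ a $\mathbb Z_2\mathbb Z_4$-additive 1-perfect code with $\alpha=2^r-1$ and $\beta=2^{t-1}-2^{r-1}$.) -/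

import Mathlib

/-- The ambient group `ℤ₂^α × ℤ₄^β`; a `ℤ₂ℤ₄`-additive code is an additive subgroup of it. -/
abbrev Z2Z4 (α β : ℕ) : Type := (Fin α → ZMod 2) × (Fin β → ZMod 4)

/-- The classical Gray map `ℤ₄ → ℤ₂²`: `0 ↦ 00`, `1 ↦ 01`, `2 ↦ 11`, `3 ↦ 10`. -/
def gray (a : ZMod 4) : Fin 2 → ZMod 2 :=
  if a = 0 then ![0, 0] else if a = 1 then ![0, 1] else if a = 2 then ![1, 1] else ![1, 0]

/-- The extended Gray map `Φ (u | u') = (u | φ(u'₁), …, φ(u'_β))`. Its `α + 2β` binary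
coordinate positions are indexed by `Fin α ⊕ Fin β × Fin 2`. -/
def grayMap {α β : ℕ} (u : Z2Z4 α β) : Fin α ⊕ Fin β × Fin 2 → ZMod 2 :=
  Sum.elim u.1 (fun k => gray (u.2 k.1) k.2)

/-- A binary code is 1-perfect if every binary vector is at Hamming distance at most one from
exactly one codeword. -/
def IsOnePerfect {ι : Type*} [Fintype ι] (C : Set (ι → ZMod 2)) : Prop :=
  ∀ v : ι → ZMod 2, ∃! c : ι → ZMod 2, c ∈ C ∧ hammingDist v c ≤ 1

/-- A `ℤ₂ℤ₄`-additive code is 1-perfect if its binary Gray image is. -/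
def IsAdditiveOnePerfect {α β : ℕ} (C : AddSubgroup (Z2Z4 α β)) : Prop :=
  IsOnePerfect (grayMap '' (C : Set (Z2Z4 α β)))

/-- The right cyclic shift `(v₁, …, v_m) ↦ (v_m, v₁, …, v_{m-1})`. -/
def cyclicShift {R : Type*} {m : ℕ} (v : Fin m → R) : Fin m → R :=
  fun i => v ((finRotate m).symm i)

/-- The double right cyclic shift `σ (u | u') = (σ u | σ u')`. -/
def doubleShift {α β : ℕ} (u : Z2Z4 α β) : Z2Z4 α β :=
  (cyclicShift u.1, cyclicShift u.2)

/-- A `ℤ₂ℤ₄`-additive code is `ℤ₂ℤ₄`-cyclic if it is closed under the double cyclic shift. -/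
def IsZ2Z4Cyclic {α β : ℕ} (C : AddSubgroup (Z2Z4 α β)) : Prop :=
  ∀ x ∈ C, doubleShift x ∈ C

/-- The parity bit of `u`: the sum modulo 2 of all the bits of its Gray image. -/
def parityBit {α β : ℕ} (u : Z2Z4 α β) : ZMod 2 := ∑ k, grayMap u k

theorem gray_sum_add (a b : ZMod 4) :
    ∑ j, gray (a + b) j = ∑ j, gray a j + ∑ j, gray b j := by
  revert a b; decide

theorem parityBit_eq {α β : ℕ} (u : Z2Z4 α β) :
    parityBit u = ∑ i, u.1 i + ∑ j, ∑ b, gray (u.2 j) b := by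
  simp [parityBit, grayMap, Fintype.sum_prod_type]

theorem parityBit_add {α β : ℕ} (u v : Z2Z4 α β) :
    parityBit (u + v) = parityBit u + parityBit v := by
  simp only [parityBit_eq, Prod.fst_add, Prod.snd_add, Pi.add_apply, gray_sum_add,
    Finset.sum_add_distrib]
  abel

/-- Adding an even parity check coordinate to a vector, as the `p`-th of the now `α + 1`
binary coordinates. -/
def extendHom {α β : ℕ} (p : Fin (α + 1)) : Z2Z4 α β →+ Z2Z4 (α + 1) β :=
  AddMonoidHom.mk'
    (fun u => (Fin.insertNth (α := fun _ => ZMod 2) p (parityBit u) u.1, u.2))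
    (by
      intro u v
      refine Prod.ext ?_ rfl
      funext i
      refine Fin.succAboveCases p ?_ (fun j => ?_) i
      · simp [parityBit_add]
      · simp)

/-- The extended code: an even parity check coordinate, at position `p` of the binary part, is
added to each codeword. -/
def extendedCode {α β : ℕ} (p : Fin (α + 1)) (C : AddSubgroup (Z2Z4 α β)) :
    AddSubgroup (Z2Z4 (α + 1) β) :=
  C.map (extendHom p)

/-! Suppose the extended code is cyclic, and let `G` be the quotient of the ambient group by it. The
shift induces an endomorphism `σ` of `G`, parity a character. Perfectness says that each odd coset
contains exactly one error of Lee weight one. So the odd elements of `G` are, without repetition,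
the binary syndromes `e i` and the quaternary ones `f j`, `-f j`: `α + 1 + 2 * β = 2 ^ t` in all.
The `e i` are the odd elements of the 2-torsion, an affine hyperplane of size `2 ^ r` in dimension
`r + 1`, on which `σ` is a full cycle. A unipotent map in that dimension has too small an order once
`r ≥ 3`, so there are 1, 2 or 4 of the `e i`. The doubles of the `f j` are nonzero even 2-torsion
elements, and cyclicity makes them all equal. Hence `2 * b ≤ a + 1`, which leaves total length 8 as
the only threat (`a = 3`, `b = 2`), excluded by hand. -/

/-! ### Unipotent maps and cyclic affine hyperplanes over `ZMod 2`. -/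

open Polynomial in
/-- An endomorphism of a finite space over `ZMod 2` whose order is a power of two satisfies
`τ ^ 2 ^ s = 1` as soon as the dimension is at most `2 ^ s`. -/
theorem pow_two_pow_eq_one_of_finrank_le {W : Type*} [AddCommGroup W] [Module (ZMod 2) W]
    [Module.Finite (ZMod 2) W] (τ : Module.End (ZMod 2) W) {r s : ℕ} (hr : τ ^ 2 ^ r = 1)
    (hs : Module.finrank (ZMod 2) W ≤ 2 ^ s) : τ ^ 2 ^ s = 1 := by
  have key : ∀ k : ℕ, (τ - 1) ^ 2 ^ k = τ ^ 2 ^ k - 1 := by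
    intro k
    have h : ((X : (ZMod 2)[X]) - 1) ^ 2 ^ k = X ^ 2 ^ k - 1 := by
      rw [sub_pow_char_pow, one_pow]
    simpa using congrArg (aeval τ) h
  have hnil : IsNilpotent (τ - 1) := ⟨2 ^ r, by rw [key, hr, sub_self]⟩
  have hch := (τ - 1).aeval_self_charpoly
  rw [hnil.charpoly_eq_X_pow_finrank, map_pow, aeval_X] at hch
  exact sub_eq_zero.1 ((key s).symm.trans (pow_eq_zero_of_le hs hch))

theorem iterate_finRotate {W : Type*} {a : ℕ} (τ : W → W) (w : Fin (a + 1) → W)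
    (hτ : ∀ i, τ (w i) = w (finRotate _ i)) (n : ℕ) (i : Fin (a + 1)) :
    τ^[n] (w i) = w (i + Fin.ofNat (a + 1) n) := by
  induction n with
  | zero => simp
  | succ k ih =>
    rw [Function.iterate_succ_apply', ih, hτ, finRotate_apply, add_assoc]
    congr 2
    ext
    simp [Fin.val_add, Fin.ofNat]

/-- An affine hyperplane of a finite space over `ZMod 2` permuted cyclically by a linear map
has one, two or four elements. -/
theorem card_of_cyclic_hyperplane {W : Type*} [AddCommGroup W] [Module (ZMod 2) W] [Finite W]
    {a : ℕ} (τ : W →+ W) (π : W →+ ZMod 2) (w : Fin (a + 1) → W) (hinj : Function.Injective w)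
    (hπ : ∀ i, π (w i) = 1) (hcov : ∀ x, π x = 1 → ∃ i, x = w i)
    (hτ : ∀ i, τ (w i) = w (finRotate _ i)) : a + 1 = 1 ∨ a + 1 = 2 ∨ a + 1 = 4 := by
  have : Module.Finite (ZMod 2) W := Module.Finite.of_finite
  let T : Module.End (ZMod 2) W := τ.toZModLinearMap 2
  have hT : ∀ n x, (T ^ n) x = τ^[n] x := fun n x => by
    rw [Module.End.pow_apply]; rfl
  -- The space is the hyperplane together with its translate through the origin, so its order is
  -- twice `a + 1`.
  let g : Fin (a + 1) × Fin 2 → W := fun k => if k.2 = 0 then w k.1 else w k.1 - w 0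
  have hspan : ∀ x : W, (∃ i, x = w i) ∨ ∃ i, x = w i - w 0 := by
    intro x
    rcases (by decide : ∀ c : ZMod 2, c = 1 ∨ c = 0) (π x) with h | h
    · exact Or.inl (hcov x h)
    · obtain ⟨i, hi⟩ := hcov (x + w 0) (by rw [map_add, h, hπ, zero_add])
      exact Or.inr ⟨i, by rw [← hi, add_sub_cancel_right]⟩
  have hg : Function.Bijective g := by
    constructor
    · rintro ⟨i, k⟩ ⟨j, l⟩ h
      have h' := congrArg π h
      fin_cases k <;> fin_cases l <;> simp [g, hπ] at h h' ⊢ <;> exact hinj h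
    · intro x
      rcases hspan x with ⟨i, rfl⟩ | ⟨i, rfl⟩
      · exact ⟨(i, 0), by simp [g]⟩
      · exact ⟨(i, 1), by simp [g]⟩
  have hcard : (a + 1) * 2 = 2 ^ Module.finrank (ZMod 2) W := by
    have h1 := Nat.card_eq_of_bijective g hg
    rw [Module.natCard_eq_pow_finrank (K := ZMod 2) (V := W)] at h1
    simpa using h1
  obtain ⟨r, hr⟩ : ∃ r, Module.finrank (ZMod 2) W = r + 1 := by
    refine Nat.exists_eq_succ_of_ne_zero fun h => ?_
    rw [h] at hcard; omega
  have har : a + 1 = 2 ^ r := by rw [hr, pow_succ] at hcard; omega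
  have hone : ∀ n, T ^ n = 1 ↔ a + 1 ∣ n := by
    intro n
    have horb := iterate_finRotate τ w hτ n
    constructor
    · intro h
      have h0 := horb 0
      rw [← hT, h, Module.End.one_apply, zero_add] at h0
      have := congrArg Fin.val (hinj h0)
      simpa [Fin.ofNat, Nat.dvd_iff_mod_eq_zero, eq_comm] using this
    · intro h
      have hw : ∀ i, (T ^ n) (w i) = w i := fun i => by
        rw [hT, horb]
        congr 1
        ext
        simp [Fin.ofNat, Nat.mod_eq_zero_of_dvd h]
      ext x
      rcases hspan x with ⟨i, rfl⟩ | ⟨i, rfl⟩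
      · exact hw i
      · rw [map_sub, hw, hw]; rfl
  have hbig : r < 3 := by
    by_contra! h3
    obtain ⟨s, rfl⟩ : ∃ s, r = s + 3 := ⟨r - 3, by omega⟩
    -- The dimension is at most half of the order `2 ^ r` of `T`, so already half that power would
    -- be the identity.
    have hle : s + 3 + 1 ≤ 2 ^ (s + 2) := by
      have := Nat.lt_two_pow_self (n := s)
      rw [pow_add]; omega
    have h1 := pow_two_pow_eq_one_of_finrank_le T ((hone _).2 har.dvd) (hr.le.trans hle)
    rw [hone, har] at h1
    have := Nat.le_of_dvd (by positivity) h1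
    rw [pow_succ 2 (s + 2)] at this
    have : 0 < 2 ^ (s + 2) := by positivity
    omega
  interval_cases r <;> simp at har ⊢ <;> omega

/-! ### Bounding the length of a cyclic system of syndromes. -/

/-- Elements `e i` of order two and `f j` of order four, forming together with the `-f j` the
nontrivial coset of a subgroup of index two, such that some endomorphism permutes the `e i`
cyclically and the `f j` cyclically. -/
structure CyclicSyndromes (G : Type*) [AddCommGroup G] (a b : ℕ) where
  σ : G →+ G
  π : G →+ ZMod 2
  e : Fin (a + 1) → G
  f : Fin b → G
  π_e : ∀ i, π (e i) = 1
  π_f : ∀ j, π (f j) = 1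
  σ_e : ∀ i, σ (e i) = e (finRotate _ i)
  σ_f : ∀ j, σ (f j) = f (finRotate _ j)
  e_add_self : ∀ i, e i + e i = 0
  f_double : ∀ j, f j + f j + (f j + f j) = 0
  f_add_self_ne : ∀ j, f j + f j ≠ 0
  e_injective : Function.Injective e
  f_injective : Function.Injective f
  f_ne_neg : ∀ j k, f j ≠ -f k
  cover : ∀ x, π x = 1 → (∃ i, x = e i) ∨ (∃ j, x = f j) ∨ ∃ j, x = -f j

namespace CyclicSyndromes

variable {G : Type*} [AddCommGroup G] {a b : ℕ} (S : CyclicSyndromes G a b)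

theorem exists_eq_e {x : G} (hx : S.π x = 1) (h2 : x + x = 0) : ∃ i, x = S.e i := by
  rcases S.cover x hx with h | ⟨j, rfl⟩ | ⟨j, rfl⟩
  · exact h
  · exact absurd h2 (S.f_add_self_ne j)
  · exact absurd (by rwa [← neg_add, neg_eq_zero] at h2) (S.f_add_self_ne j)

theorem card_e [Finite G] (S : CyclicSyndromes G a b) : a + 1 = 1 ∨ a + 1 = 2 ∨ a + 1 = 4 := by
  let W : AddSubgroup G := (nsmulAddMonoidHom 2 : G →+ G).ker
  have hW : ∀ x, x ∈ W ↔ x + x = 0 := fun x => by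
    simp [W, AddMonoidHom.mem_ker, two_nsmul]
  let : Module (ZMod 2) W := AddCommGroup.zmodModule (n := 2) fun x => by
    rw [two_nsmul]
    exact Subtype.ext ((hW x).1 x.2)
  let τ : W →+ W := (S.σ.comp W.subtype).codRestrict W fun x => by
    rw [hW, ← map_add]
    simp [(hW x).1 x.2]
  refine card_of_cyclic_hyperplane τ (S.π.comp W.subtype)
    (fun i => ⟨S.e i, (hW _).2 (S.e_add_self i)⟩) ?_ (fun i => S.π_e i) ?_ ?_
  · intro i j h
    exact S.e_injective (congrArg Subtype.val h)
  · rintro ⟨x, hx⟩ h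
    obtain ⟨i, hi⟩ := S.exists_eq_e h ((hW x).1 hx)
    exact ⟨i, Subtype.ext hi⟩
  · intro i
    exact Subtype.ext (S.σ_e i)

/-- Adding `e 0` to the double of `f j` gives an odd element killed by 2; `i = 0` would make the
double vanish. -/
theorem exists_f_add_f (j : Fin b) : ∃ i, i ≠ 0 ∧ S.f j + S.f j = S.e 0 + S.e i := by
  obtain ⟨i, hi⟩ := S.exists_eq_e (x := S.f j + S.f j + S.e 0)
    (by simp only [map_add, S.π_e, S.π_f]; decide)
    (by have := S.f_double j; have := S.e_add_self 0; grind)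
  have h0 := S.e_add_self 0
  refine ⟨i, ?_, by grind⟩
  rintro rfl
  exact S.f_add_self_ne j (by grind)

/-- If all `f j` have the same double, there are at most as many `±f j` as `e i`. -/
theorem card_f_le {z : G} (hz : ∀ j, S.f j + S.f j = z) : 2 * b ≤ a + 1 := by
  rcases b with _ | b
  · simp
  let g : Fin (b + 1) × Bool → G := fun k => if k.2 then S.f k.1 else -S.f k.1
  -- Two elements `±f j` and `f 0` of equal double have a 2-torsion sum; adding `e 0` makes it odd,
  -- so translation embeds the `±f j` into the `e i`.
  have hg : ∀ k, ∃ i, g k + S.f 0 + S.e 0 = S.e i := by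
    rintro ⟨j, s⟩
    have h1 := hz j
    have h2 := hz 0
    have h3 := S.f_double 0
    have h4 := S.e_add_self 0
    refine S.exists_eq_e ?_ ?_
    · have hs : S.π (g (j, s)) = 1 := by cases s <;> simp [g, S.π_f]
      simp only [map_add, S.π_e, S.π_f, hs]
      decide
    · cases s <;> simp only [g] <;> grind
  choose φ hφ using hg
  have hinj : Function.Injective φ := by
    intro k l h
    have hkl : g k = g l := by
      have h1 := hφ k
      rw [h, ← hφ l] at h1
      simpa using h1
    obtain ⟨j, s⟩ := k
    obtain ⟨j', s'⟩ := l
    have h1 := S.f_ne_neg j j'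
    have h2 := S.f_ne_neg j' j
    have h3 := @S.f_injective j j'
    cases s <;> cases s' <;> simp [g] at hkl ⊢ <;> grind
  have := Fintype.card_le_of_injective φ hinj
  simp at this
  omega

theorem iterate_f (j k : Fin b) : ∃ n, S.σ^[n] (S.f j) = S.f k := by
  rcases b with _ | b
  · exact j.elim0
  refine ⟨(k - j).val, ?_⟩
  rw [iterate_finRotate _ _ S.σ_f]
  congr 1
  rw [Fin.ofNat_val_eq_self, add_sub_cancel]

theorem e_sum_four (S : CyclicSyndromes G 3 b) : S.e 0 + S.e 1 + S.e 2 = S.e 3 := by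
  have h0 := S.e_add_self 0
  have h1 := S.e_add_self 1
  have h2 := S.e_add_self 2
  obtain ⟨i, hi⟩ := S.exists_eq_e (x := S.e 0 + S.e 1 + S.e 2)
    (by simp only [map_add, S.π_e]; decide) (by grind)
  have h01 : S.e 0 ≠ S.e 1 := S.e_injective.ne (by decide)
  have h02 : S.e 0 ≠ S.e 2 := S.e_injective.ne (by decide)
  have h12 : S.e 1 ≠ S.e 2 := S.e_injective.ne (by decide)
  fin_cases i <;> simp at hi <;> grind

/-- The element `e 0 + e 2` is fixed by `σ`, since the four `e i` sum to zero. As `σ` is transitive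
on the `f j`, one `f k` with this double suffices. -/
theorem f_add_f_four (S : CyclicSyndromes G 3 b) (j : Fin b) :
    S.f j + S.f j = S.e 0 + S.e 2 := by
  have h0 := S.e_add_self 0
  have h1 := S.e_add_self 1
  have h2 := S.e_add_self 2
  have h3 := S.e_add_self 3
  have hsum := S.e_sum_four
  have h02 : S.e 0 ≠ S.e 2 := S.e_injective.ne (by decide)
  have s0 : S.σ (S.e 0) = S.e 1 := S.σ_e 0
  have s1 : S.σ (S.e 1) = S.e 2 := S.σ_e 1
  have s2 : S.σ (S.e 2) = S.e 3 := S.σ_e 2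
  have s3 : S.σ (S.e 3) = S.e 0 := S.σ_e 3
  have hfix : S.σ (S.e 0 + S.e 2) = S.e 0 + S.e 2 := by
    rw [map_add, s0, s2]; grind
  have hprop : ∀ k, S.f k + S.f k = S.e 0 + S.e 2 → S.f j + S.f j = S.e 0 + S.e 2 := by
    intro k hk
    obtain ⟨n, hn⟩ := S.iterate_f k j
    rw [← hn, ← iterate_map_add, hk, Function.iterate_fixed hfix]
  -- The odd element `f j + σ (f j) + e 0` then has the nonzero double `e 0 + e 2`, so it is some
  -- `±f k`.
  have hsumf : S.f j + S.f j + S.σ (S.f j + S.f j) = S.e 0 + S.e 2 →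
      S.f j + S.f j = S.e 0 + S.e 2 := by
    intro h
    rw [map_add, S.σ_f] at h
    have hx : S.π (S.f j + S.f (finRotate b j) + S.e 0) = 1 := by
      simp only [map_add, S.π_e, S.π_f]; decide
    rcases S.cover _ hx with ⟨i, hi⟩ | ⟨k, hk⟩ | ⟨k, hk⟩
    · have := S.e_add_self i
      grind
    · exact hprop k (by grind)
    · have hk' := hk ▸ neg_add_cancel (S.f k)
      exact hprop k (by grind)
  obtain ⟨i, hi, hj⟩ := S.exists_f_add_f j
  rw [hj] at hsumf ⊢
  rw [map_add, s0] at hsumf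
  -- For `i = 1` or `i = 3` the double plus its shift is `e 0 + e 2`.
  fin_cases i <;> simp [s1, s2, s3] at hi hsumf ⊢
  · exact hsumf (by grind)
  · exact hsumf (by grind)

/-- The sum `f 0 + f 1` is fixed by `σ` and equals some `e 0 + e i`. Invariance excludes `i = 1, 3`;
`i = 0` gives `f 0 = -f 1`, and `i = 2` gives `f 0 = f 1`. -/
theorem false_of_four_two (S : CyclicSyndromes G 3 2) : False := by
  have h0 := S.e_add_self 0
  have hf0 := S.f_add_f_four 0
  have hf1 := S.f_add_f_four 1
  have s0 : S.σ (S.e 0) = S.e 1 := S.σ_e 0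
  have s1 : S.σ (S.e 1) = S.e 2 := S.σ_e 1
  have s3 : S.σ (S.e 3) = S.e 0 := S.σ_e 3
  have t0 : S.σ (S.f 0) = S.f 1 := S.σ_f 0
  have t1 : S.σ (S.f 1) = S.f 0 := S.σ_f 1
  have h02 : S.e 0 ≠ S.e 2 := S.e_injective.ne (by decide)
  have h13 : S.e 1 ≠ S.e 3 := S.e_injective.ne (by decide)
  have hne : S.f 0 ≠ S.f 1 := S.f_injective.ne (by decide)
  have hneg : S.f 0 + S.f 1 ≠ 0 := fun h => S.f_ne_neg 0 1 (eq_neg_of_add_eq_zero_left h)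
  have hd := S.f_double 0
  obtain ⟨i, hi⟩ := S.exists_eq_e (x := S.f 0 + S.f 1 + S.e 0)
    (by simp only [map_add, S.π_e, S.π_f]; decide) (by grind)
  have hσ := congrArg S.σ hi
  rw [map_add, map_add, t0, t1, s0] at hσ
  fin_cases i <;> simp [s0, s1, s3] at hi hσ <;> grind

theorem length_lt [Finite G] (S : CyclicSyndromes G a b) : a + 1 + 2 * b < 8 := by
  have hex := S.exists_f_add_f
  rcases S.card_e with h | h | h
  · obtain rfl : a = 0 := by omega
    rcases b with _ | b
    · omega
    · obtain ⟨i, hi, -⟩ := hex 0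
      exact absurd (Fin.fin_one_eq_zero i) hi
  · obtain rfl : a = 1 := by omega
    have := S.card_f_le (z := S.e 0 + S.e 1) fun j => by
      obtain ⟨i, hi, hj⟩ := hex j
      rwa [Fin.eq_one_of_ne_zero i hi] at hj
    omega
  · obtain rfl : a = 3 := by omega
    have := S.card_f_le S.f_add_f_four
    rcases (by omega : b < 2 ∨ b = 2) with hb | rfl
    · omega
    · exact S.false_of_four_two.elim

end CyclicSyndromes

/-! ### Lee weight and vectors of weight one. -/

/-- The Lee weight of a vector, i.e. the Hamming weight of its Gray image. -/
def leeWeight {α β : ℕ} (u : Z2Z4 α β) : ℕ :=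
  ∑ i, (u.1 i).val + ∑ j, ∑ b, (gray (u.2 j) b).val

/-- The Gray map is not additive, but on each coordinate the number of differing bits depends only
on the difference. -/
theorem hammingDist_grayMap {α β : ℕ} (u v : Z2Z4 α β) :
    hammingDist (grayMap u) (grayMap v) = leeWeight (u - v) := by
  have h2 : ∀ x y : ZMod 2, (if x ≠ y then 1 else 0) = (x - y).val := by decide
  have h4 : ∀ x y : ZMod 4, ∑ b, (gray x b - gray y b).val = ∑ b, (gray (x - y) b).val := by
    decide
  have hd : hammingDist (grayMap u) (grayMap v) = ∑ k, (grayMap u k - grayMap v k).val := by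
    rw [hammingDist, Finset.card_filter]
    exact Finset.sum_congr rfl fun k _ => h2 _ _
  rw [hd]
  simp only [Fintype.sum_sum_type, Fintype.sum_prod_type, grayMap, Sum.elim_inl, Sum.elim_inr,
    h4, leeWeight, Prod.fst_sub, Prod.snd_sub, Pi.sub_apply]

theorem parityBit_eq_leeWeight {α β : ℕ} (u : Z2Z4 α β) : parityBit u = leeWeight u := by
  simp [parityBit_eq, leeWeight]

def parityHom {α β : ℕ} : Z2Z4 α β →+ ZMod 2 := AddMonoidHom.mk' parityBit parityBit_add

theorem leeWeight_single_left {α β : ℕ} (i : Fin α) :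
    leeWeight ((Pi.single i 1, 0) : Z2Z4 α β) = 1 := by
  have h : ∀ k, ((Pi.single i 1 : Fin α → ZMod 2) k).val = if k = i then 1 else 0 := by
    intro k
    by_cases hk : k = i
    · subst hk; simp; rfl
    · simp [hk]
  simp [leeWeight, h, gray]

theorem leeWeight_single_right {α β : ℕ} (j : Fin β) (c : ZMod 4) :
    leeWeight ((0, Pi.single j c) : Z2Z4 α β) = ∑ b, (gray c b).val := by
  rw [leeWeight, Finset.sum_eq_single j]
  · simp
  · intro k _ hk; simp [hk, gray]
  · simp

theorem leeWeight_eq_zero {α β : ℕ} {u : Z2Z4 α β} (h : leeWeight u = 0) : u = 0 := by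
  have h4 : ∀ x : ZMod 4, ∑ b, (gray x b).val = 0 → x = 0 := by decide
  simp only [leeWeight, Nat.add_eq_zero_iff, Finset.sum_eq_zero_iff, Finset.mem_univ, true_implies,
    ZMod.val_eq_zero] at h
  refine Prod.ext (funext h.1) (funext fun j => h4 _ ?_)
  simpa using h.2 j

theorem leeWeight_eq_one {α β : ℕ} {u : Z2Z4 α β} (h : leeWeight u = 1) :
    (∃ i, u = (Pi.single i 1, 0)) ∨ (∃ j, u = (0, Pi.single j 1)) ∨
      ∃ j, u = (0, -Pi.single j 1) := by
  have h2 : ∀ x : ZMod 2, x.val ≠ 0 → x = 1 := by decide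
  have h4 : ∀ x : ZMod 4, ∑ b, (gray x b).val = 0 → x = 0 := by decide
  have h4' : ∀ x : ZMod 4, ∑ b, (gray x b).val = 1 → x = 1 ∨ x = -1 := by decide
  have hA : ∀ i, (u.1 i).val ≠ 0 → u = (Pi.single i 1, 0) := by
    intro i hi
    have hs := Finset.add_sum_erase Finset.univ (fun i => (u.1 i).val) (Finset.mem_univ i)
    have h0 : ∑ k ∈ Finset.univ.erase i, (u.1 k).val = 0 := by
      simp only [leeWeight] at h; omega
    have h0' : ∑ j, ∑ b, (gray (u.2 j) b).val = 0 := by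
      simp only [leeWeight] at h; omega
    rw [Finset.sum_eq_zero_iff] at h0 h0'
    refine Prod.ext (funext fun k => ?_) (funext fun j => h4 _ (h0' j (Finset.mem_univ j)))
    by_cases hk : k = i
    · subst hk; simpa using h2 _ hi
    · simpa [hk] using h0 k (by simp [hk])
  by_cases hne : ∃ i, (u.1 i).val ≠ 0
  · obtain ⟨i, hi⟩ := hne
    exact Or.inl ⟨i, hA i hi⟩
  push Not at hne
  have hu : u.1 = 0 := funext fun i => by simpa using hne i
  have hsum : ∑ j, ∑ b, (gray (u.2 j) b).val = 1 := by
    simpa [leeWeight, hu] using h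
  obtain ⟨j, -, hj⟩ := Finset.exists_ne_zero_of_sum_ne_zero (hsum.trans_ne one_ne_zero)
  have hs := Finset.add_sum_erase Finset.univ (fun j => ∑ b, (gray (u.2 j) b).val)
    (Finset.mem_univ j)
  have h0 : ∑ k ∈ Finset.univ.erase j, ∑ b, (gray (u.2 k) b).val = 0 := by
    omega
  have h1 : ∑ b, (gray (u.2 j) b).val = 1 := by
    omega
  rw [Finset.sum_eq_zero_iff] at h0
  have hsing : u.2 = Pi.single j (u.2 j) := by
    funext k
    by_cases hk : k = j
    · subst hk; simp
    · simpa [hk] using h4 _ (h0 k (by simp [hk]))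
  rcases h4' _ h1 with h1 | h1 <;> rw [h1] at hsing
  · exact Or.inr (Or.inl ⟨j, Prod.ext hu hsing⟩)
  · exact Or.inr (Or.inr ⟨j, Prod.ext hu (by rw [hsing, Pi.single_neg])⟩)

/-! ### Puncturing and the extended code. -/

/-- Deleting the binary coordinate `p`. -/
def puncture {α β : ℕ} (p : Fin (α + 1)) : Z2Z4 (α + 1) β →+ Z2Z4 α β :=
  AddMonoidHom.mk' (fun u => (fun i => u.1 (p.succAbove i), u.2)) fun _ _ => rfl

theorem leeWeight_puncture {α β : ℕ} (p : Fin (α + 1)) (u : Z2Z4 (α + 1) β) :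
    leeWeight u = (u.1 p).val + leeWeight (puncture p u) := by
  simp [leeWeight, puncture, Fin.sum_univ_succAbove _ p, add_assoc]

theorem ext_puncture {α β : ℕ} {p : Fin (α + 1)} {u v : Z2Z4 (α + 1) β}
    (hπ : parityBit u = parityBit v) (h : puncture p u = puncture p v) : u = v := by
  have hp : u.1 p = v.1 p := by
    simpa [parityBit_eq_leeWeight, leeWeight_puncture p, h] using hπ
  refine Prod.ext (funext fun i => ?_) (congrArg (fun w => w.2) h :)
  refine Fin.succAboveCases p hp (fun k => ?_) i
  exact congrFun (congrArg (fun w => w.1) h) k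

theorem puncture_insertNth {α β : ℕ} (p : Fin (α + 1)) (x : ZMod 2) (u : Z2Z4 α β) :
    puncture p ((Fin.insertNth (α := fun _ => ZMod 2) p x u.1, u.2) : Z2Z4 (α + 1) β) = u := by
  refine Prod.ext (funext fun i => ?_) rfl
  simp [puncture]

theorem leeWeight_insertNth {α β : ℕ} (p : Fin (α + 1)) (x : ZMod 2) (u : Z2Z4 α β) :
    leeWeight ((Fin.insertNth (α := fun _ => ZMod 2) p x u.1, u.2) : Z2Z4 (α + 1) β)
      = x.val + leeWeight u := by
  rw [leeWeight_puncture p, puncture_insertNth]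
  simp

theorem mem_extendedCode {α β : ℕ} {p : Fin (α + 1)} {C : AddSubgroup (Z2Z4 α β)}
    {x : Z2Z4 (α + 1) β} :
    x ∈ extendedCode p C ↔ parityBit x = 0 ∧ puncture p x ∈ C := by
  have hpar : ∀ u : Z2Z4 α β, parityBit (extendHom p u) = 0 := fun u => by
    have h : extendHom p u
        = (Fin.insertNth (α := fun _ => ZMod 2) p (parityBit u) u.1, u.2) := rfl
    rw [h, parityBit_eq_leeWeight, leeWeight_insertNth]
    simp [parityBit_eq_leeWeight, CharTwo.add_self_eq_zero]
  have hpunct : ∀ u : Z2Z4 α β, puncture p (extendHom p u) = u := fun u =>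
    puncture_insertNth p _ u
  constructor
  · rintro ⟨u, hu, rfl⟩
    exact ⟨hpar u, by rwa [hpunct]⟩
  · rintro ⟨h0, hx⟩
    exact ⟨_, hx, ext_puncture (p := p) (by rw [hpar, h0]) (hpunct _)⟩

/-! ### Error correction in perfect and extended codes. -/

theorem IsAdditiveOnePerfect.exists_error {α β : ℕ} {C : AddSubgroup (Z2Z4 α β)}
    (hC : IsAdditiveOnePerfect C) (y : Z2Z4 α β) : ∃ d, leeWeight d ≤ 1 ∧ y - d ∈ C := by
  obtain ⟨_, ⟨⟨c, hc, rfl⟩, hd⟩, -⟩ := hC (grayMap y)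
  exact ⟨y - c, by rwa [← hammingDist_grayMap], by simpa using hc⟩

theorem IsAdditiveOnePerfect.error_unique {α β : ℕ} {C : AddSubgroup (Z2Z4 α β)}
    (hC : IsAdditiveOnePerfect C) {d d' : Z2Z4 α β} (hd : leeWeight d ≤ 1)
    (hd' : leeWeight d' ≤ 1) (h : d - d' ∈ C) : d = d' := by
  -- Both `d - d'` and `0` are codewords within distance one of `d`.
  have key := (hC (grayMap d)).unique
    ⟨⟨_, h, rfl⟩, by rw [hammingDist_grayMap, sub_sub_cancel]; exact hd'⟩
    ⟨⟨0, C.zero_mem, rfl⟩, by rw [hammingDist_grayMap, sub_zero]; exact hd⟩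
  have h0 : leeWeight (d - d' - 0) = 0 := by
    rw [← hammingDist_grayMap, key, hammingDist_self]
  simpa [sub_eq_zero] using leeWeight_eq_zero h0

theorem exists_odd_error {α β : ℕ} {C : AddSubgroup (Z2Z4 α β)} (hC : IsAdditiveOnePerfect C)
    (p : Fin (α + 1)) {x : Z2Z4 (α + 1) β} (hx : parityBit x = 1) :
    ∃ d, leeWeight d = 1 ∧ x - d ∈ extendedCode p C := by
  obtain ⟨d, hd, hmem⟩ := hC.exists_error (puncture p x)
  -- The inserted bit is 1 exactly when `d = 0`, which makes the weight one.
  let d' : Z2Z4 (α + 1) β :=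
    (Fin.insertNth (α := fun _ => ZMod 2) p (1 + parityBit d) d.1, d.2)
  have hd' : leeWeight d' = 1 := by
    rw [leeWeight_insertNth, parityBit_eq_leeWeight]
    interval_cases leeWeight d <;> rfl
  refine ⟨d', hd', mem_extendedCode.2 ⟨?_, ?_⟩⟩
  · have h := parityBit_add (x - d') d'
    rw [sub_add_cancel, hx, parityBit_eq_leeWeight d', hd', Nat.cast_one] at h
    exact (add_eq_right.1 h.symm)
  · rw [map_sub, puncture_insertNth]; exact hmem

theorem odd_error_unique {α β : ℕ} {C : AddSubgroup (Z2Z4 α β)} (hC : IsAdditiveOnePerfect C)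
    (p : Fin (α + 1)) {d d' : Z2Z4 (α + 1) β} (hd : leeWeight d = 1) (hd' : leeWeight d' = 1)
    (h : d - d' ∈ extendedCode p C) : d = d' := by
  refine ext_puncture (p := p) (by simp [parityBit_eq_leeWeight, hd, hd']) ?_
  have h1 := leeWeight_puncture p d
  have h2 := leeWeight_puncture p d'
  refine hC.error_unique (by omega) (by omega) ?_
  rw [← map_sub]
  exact (mem_extendedCode.1 h).2

/-! ### Syndromes of a cyclic extended code. -/

/-- The double cyclic shift as a group homomorphism. -/
def doubleShiftHom {α β : ℕ} : Z2Z4 α β →+ Z2Z4 α β :=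
  AddMonoidHom.mk' doubleShift fun _ _ => rfl

theorem cyclicShift_single {R : Type*} [Zero R] {m : ℕ} (i : Fin m) (c : R) :
    cyclicShift (Pi.single i c) = Pi.single (finRotate m i) c := by
  funext k
  simp only [cyclicShift, Pi.single_apply, Equiv.symm_apply_eq]

theorem leeWeight_neg {α β : ℕ} (u : Z2Z4 α β) : leeWeight (-u) = leeWeight u := by
  rw [← zero_sub, ← hammingDist_grayMap, hammingDist_comm, hammingDist_grayMap, sub_zero]

theorem single_one_ne_neg {β : ℕ} (j : Fin β) :
    (Pi.single j 1 : Fin β → ZMod 4) ≠ -Pi.single j 1 := by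
  intro h
  have := congrFun h j
  simp only [Pi.neg_apply, Pi.single_eq_same] at this
  exact absurd this (by decide)

/-- The cosets of the unit errors form a system of cyclic syndromes. -/
def cyclicSyndromes {α β : ℕ} {C : AddSubgroup (Z2Z4 α β)} (hC : IsAdditiveOnePerfect C)
    (p : Fin (α + 1)) (hcyc : IsZ2Z4Cyclic (extendedCode p C)) :
    CyclicSyndromes (Z2Z4 (α + 1) β ⧸ extendedCode p C) α β :=
  have hwl : ∀ i, leeWeight ((Pi.single i 1, 0) : Z2Z4 (α + 1) β) = 1 := leeWeight_single_left
  have hwr : ∀ j, leeWeight ((0, Pi.single j 1) : Z2Z4 (α + 1) β) = 1 := fun j => by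
    rw [leeWeight_single_right]; rfl
  have heq : ∀ {d d' : Z2Z4 (α + 1) β}, leeWeight d = 1 → leeWeight d' = 1 →
      ((d : Z2Z4 (α + 1) β ⧸ extendedCode p C) = d') → d = d' := fun hd hd' h =>
    odd_error_unique hC p hd hd' (QuotientAddGroup.eq_iff_sub_mem.1 h)
  { σ := QuotientAddGroup.map _ _ doubleShiftHom hcyc
    π := QuotientAddGroup.lift _ parityHom fun x hx => (mem_extendedCode.1 hx).1
    e := fun i => ((Pi.single i 1, 0) : Z2Z4 (α + 1) β)
    f := fun j => ((0, Pi.single j 1) : Z2Z4 (α + 1) β)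
    π_e := fun i => by
      change parityBit _ = 1
      rw [parityBit_eq_leeWeight, hwl, Nat.cast_one]
    π_f := fun j => by
      change parityBit _ = 1
      rw [parityBit_eq_leeWeight, hwr, Nat.cast_one]
    σ_e := fun i => by
      have h : doubleShiftHom ((Pi.single i 1, 0) : Z2Z4 (α + 1) β)
          = (Pi.single (finRotate _ i) 1, 0) := Prod.ext (cyclicShift_single i 1) rfl
      exact congrArg (QuotientAddGroup.mk (s := extendedCode p C)) h
    σ_f := fun j => by
      have h : doubleShiftHom ((0, Pi.single j 1) : Z2Z4 (α + 1) β)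
          = (0, Pi.single (finRotate β j) 1) := Prod.ext rfl (cyclicShift_single j 1)
      exact congrArg (QuotientAddGroup.mk (s := extendedCode p C)) h
    e_add_self := fun i => by
      rw [← QuotientAddGroup.mk_add, QuotientAddGroup.eq_zero_iff, Prod.mk_add_mk, add_zero,
        CharTwo.add_self_eq_zero]
      exact zero_mem _
    f_double := fun j => by
      have h : (Pi.single j 1 + Pi.single j 1 + (Pi.single j 1 + Pi.single j 1) :
          Fin β → ZMod 4) = 0 := by
        rw [← Pi.single_add, ← Pi.single_add]
        exact Pi.single_zero j
      simp only [← QuotientAddGroup.mk_add, Prod.mk_add_mk, add_zero, h]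
      rfl
    f_add_self_ne := fun j h => by
      have h' := congrArg Prod.snd
        (heq (hwr j) ((leeWeight_neg _).trans (hwr j)) (eq_neg_of_add_eq_zero_left h))
      exact single_one_ne_neg j h'
    e_injective := fun i k h => by
      have h' := congrFun (congrArg Prod.fst (heq (hwl i) (hwl k) h)) i
      by_contra hik
      simp [hik] at h'
    f_injective := fun i k h => by
      have h' := congrFun (congrArg Prod.snd (heq (hwr i) (hwr k) h)) i
      by_contra hik
      dsimp only at h'
      rw [Pi.single_eq_same, Pi.single_eq_of_ne hik] at h'
      exact absurd h' (by decide)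
    f_ne_neg := fun j k h => by
      have h' := congrArg Prod.snd (heq (hwr j) ((leeWeight_neg _).trans (hwr k)) h)
      have h'' := congrFun h' j
      simp only [Prod.snd_neg, Pi.neg_apply, Pi.single_apply] at h''
      split_ifs at h'' <;> exact absurd h'' (by decide)
    cover := fun x hx => by
      obtain ⟨x, rfl⟩ := QuotientAddGroup.mk_surjective x
      obtain ⟨d, hd, hmem⟩ := exists_odd_error hC p (x := x) hx
      have hxd := QuotientAddGroup.eq_iff_sub_mem.2 hmem
      rcases leeWeight_eq_one hd with ⟨i, rfl⟩ | ⟨j, rfl⟩ | ⟨j, rfl⟩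
      · exact Or.inl ⟨i, hxd⟩
      · exact Or.inr (Or.inl ⟨j, hxd⟩)
      · refine Or.inr (Or.inr ⟨j, hxd.trans ?_⟩)
        rw [← QuotientAddGroup.mk_neg, Prod.neg_mk, neg_zero] }

theorem theorem4p2 (t : ℕ) (ht : 3 ≤ t) (α β : ℕ) (hlen : α + 2 * β = 2 ^ t - 1)
    (C : AddSubgroup (Z2Z4 α β)) (hC : IsAdditiveOnePerfect C) (p : Fin (α + 1)) :
    ¬ IsZ2Z4Cyclic (extendedCode p C) := by
  intro hcyc
  have := (cyclicSyndromes hC p hcyc).length_lt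
  have : 2 ^ 3 ≤ 2 ^ t := Nat.pow_le_pow_right two_pos ht
  omega
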